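/- Let $M$ be a lattice of finite rank, $M_{\mathbb R}=M\otimes_{\mathbb Z}\mathbb R$, $N=\mathrm{Hom}_{\mathbb Z}(M,\mathbb Z)$ and $N_{\mathbb R}=N\otimes_{\mathbb Z}\mathbb R$. A lattice polytope is the convex hull in $M_{\mathbb R}$ of finitely many points of $M$. A full-dimensional lattice polytope $\Delta\subset M_{\mathbb R}$ is called reflexive if it has exactly one interior lattice point $m$ and the dual polytope $(\Delta-m)^*=\{y\in N_{\mathbb R} : \langle y,x\rangle\ge -1 \text{ for all } x\in\Delta-m\}$ is again a lattice polytope, with respect to $N$. A lattice polytope $\Delta$ of arbitrary dimension is called reflexive in its span if it has exactly one lattice point $m$ in its relative interior and $\Delta-m$ is reflexive as a full-dimensional polytope in its linear span $W=\mathrm{lin}(\Delta-m)$, with respect to the lattice $M\cap W$. Lattice polytopes $\Delta_1,\dots,\Delta_r$ form a nef-partition if $\Delta_1+\dots+\Delta_r$ is reflexive and there are lattice points $p_i\in\Delta_i$ such that $p_1+\dots+p_r$ is the unique interior lattice point of $\Delta_1+\dots+\Delta_r$. Let $P,Q\subset M_{\mathbb R}$ be lattice polytopes such that the Minkowski sum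 $P+Q$ is reflexive (so, in particular, full-dimensional). If $P$ contains a lattice point in its relative interior, then $P$ and $Q$ are both reflexive in their spans, and $P,Q$ form a nef-partition. -/

import Mathlib

open scoped Pointwise

/-- A lattice polytope: the convex hull of finitely many lattice points. -/
def IsLatticePolytope {V : Type*} [AddCommGroup V] [Module ℝ V]
    (L : Submodule ℤ V) (Δ : Set V) : Prop :=
  ∃ s : Finset V, (s : Set V) ⊆ L ∧ Δ = convexHull ℝ (s : Set V)

/-- The dual lattice `N = Hom(M, ℤ)` inside `N_ℝ = Hom(M_ℝ, ℝ)`: the linear forms that take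
integral values on the lattice. -/
def dualLattice {V : Type*} [AddCommGroup V] [Module ℝ V] (L : Submodule ℤ V) :
    Submodule ℤ (Module.Dual ℝ V) where
  carrier := {y | ∀ x ∈ L, ∃ n : ℤ, y x = n}
  add_mem' := by
    intro a b ha hb x hx
    obtain ⟨n, hn⟩ := ha x hx
    obtain ⟨k, hk⟩ := hb x hx
    exact ⟨n + k, by simp [hn, hk]⟩
  zero_mem' := fun _ _ => ⟨0, by simp⟩
  smul_mem' := by
    intro c a ha x hx
    obtain ⟨n, hn⟩ := ha x hx
    exact ⟨c * n, by simp [hn]⟩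

/-- The dual polytope `Δ^* = {y : ⟨y, x⟩ ≥ -1 for all x ∈ Δ}`. -/
def dualPolytope {V : Type*} [AddCommGroup V] [Module ℝ V] (Δ : Set V) :
    Set (Module.Dual ℝ V) :=
  {y | ∀ x ∈ Δ, -1 ≤ y x}

/-- A full-dimensional lattice polytope with the origin in its interior is reflexive
(with respect to the origin) if its dual polytope is a lattice polytope. -/
def IsReflexiveAtOrigin {V : Type*} [NormedAddCommGroup V] [NormedSpace ℝ V]
    (L : Submodule ℤ V) (Δ : Set V) : Prop :=
  IsLatticePolytope L Δ ∧ (0 : V) ∈ interior Δ ∧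
    IsLatticePolytope (dualLattice L) (dualPolytope Δ)

/-- A full-dimensional lattice polytope is reflexive with respect to `m` if `m` is its only
interior lattice point and `Δ - m` is reflexive with respect to the origin. -/
def IsReflexiveAt {V : Type*} [NormedAddCommGroup V] [NormedSpace ℝ V]
    (L : Submodule ℤ V) (m : V) (Δ : Set V) : Prop :=
  interior Δ ∩ L = {m} ∧ IsReflexiveAtOrigin L {x : V | m + x ∈ Δ}

/-- A full-dimensional lattice polytope that is reflexive with respect to its only interior
lattice point. -/
def IsReflexive {V : Type*} [NormedAddCommGroup V] [NormedSpace ℝ V]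
    (L : Submodule ℤ V) (Δ : Set V) : Prop :=
  ∃ m : V, IsReflexiveAt L m Δ

/-- A lattice polytope, possibly of smaller dimension, that is reflexive in its span: it has
exactly one lattice point `m` in its relative interior, and `Δ - m` is reflexive with respect to
the origin in its linear span `W`, for the lattice `W ∩ L`. -/
def IsReflexiveInSpan {V : Type*} [NormedAddCommGroup V] [NormedSpace ℝ V]
    (L : Submodule ℤ V) (Δ : Set V) : Prop :=
  ∃ m : V, intrinsicInterior ℝ Δ ∩ L = {m} ∧
    IsReflexiveAtOrigin (L.comap ((vectorSpan ℝ Δ).subtype.restrictScalars ℤ))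
      {w : vectorSpan ℝ Δ | m + (w : V) ∈ Δ}

/-- Lattice polytopes `Δ i` form a nef-partition if their Minkowski sum is a reflexive polytope
(of full dimension), with interior lattice point `m` say, and there are lattice points
`p i ∈ Δ i` whose sum is `m`. -/
def IsNefPartition {V : Type*} [NormedAddCommGroup V] [NormedSpace ℝ V]
    (L : Submodule ℤ V) {ι : Type*} [Fintype ι] (Δ : ι → Set V) : Prop :=
  (∀ i, IsLatticePolytope L (Δ i)) ∧
    ∃ m : V, IsReflexiveAt L m (∑ i, Δ i) ∧
      ∃ p : ι → V, (∀ i, p i ∈ Δ i ∧ p i ∈ L) ∧ ∑ i, p i = m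

/-! Translate so that `p` and the interior point of `P + Q` become `0`. The dual of `P + Q` is the
hull of a finite set `S` of integral forms, each at least `-1` on `P + Q`. If `y ∈ S` is negative
somewhere on `P`, integrality gives a point of `P` with `y ≤ -1`, so `y ≥ 0` on `Q`; otherwise `y ≥
0` on `P`, and `y` vanishes there because `0` is relatively interior. As `P + Q` is compact, a
vector on which all of `S` is nonnegative is `0`. This forces `0 ∈ Q` and independent spans
(`zero_mem_and_disjoint_span`). A direct summand inherits reflexivity, its dual being the
restriction of the dual of the sum (`of_add`). -/

theorem setOf_add_mem_add {V : Type*} [AddCommGroup V] (P Q : Set V) (p q : V) :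
    {x | p + q + x ∈ P + Q} = {x | p + x ∈ P} + {x | q + x ∈ Q} := by
  ext x
  constructor
  · rintro ⟨a, ha, b, hb, hab⟩
    refine ⟨-p + a, by simpa using ha, -q + b, by simpa using hb, ?_⟩
    have : x = -(p + q) + (a + b) := by rw [show a + b = p + q + x from hab]; abel
    rw [this]
    change -p + a + (-q + b) = _
    abel
  · rintro ⟨a, ha, b, hb, rfl⟩
    exact ⟨p + a, ha, q + b, hb, by change p + a + (q + b) = p + q + (a + b); abel⟩

/-! ### Lattice polytopes and integral forms -/

section LatticePolytope

variable {V : Type*} [AddCommGroup V] [Module ℝ V] {L : Submodule ℤ V} {Δ : Set V}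

theorem IsLatticePolytope.convex (h : IsLatticePolytope L Δ) : Convex ℝ Δ := by
  obtain ⟨s, -, rfl⟩ := h
  exact convex_convexHull ℝ _

theorem IsLatticePolytope.translate (h : IsLatticePolytope L Δ) {p : V} (hp : p ∈ L) :
    IsLatticePolytope L {x | p + x ∈ Δ} := by
  classical
  obtain ⟨s, hs, rfl⟩ := h
  refine ⟨s.image fun x => -p + x, ?_, ?_⟩
  · intro x hx
    obtain ⟨y, hy, rfl⟩ := Finset.mem_image.1 (Finset.mem_coe.1 hx)
    exact L.add_mem (L.neg_mem hp) (hs hy)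
  · have h : ((s.image fun x => -p + x : Finset V) : Set V) = -p +ᵥ (s : Set V) := by
      rw [Finset.coe_image]; rfl
    rw [h, convexHull_vadd]
    ext x
    rw [Set.mem_vadd_set_iff_neg_vadd_mem]
    simp

/-- A lattice polytope contained in a subspace is a lattice polytope for the induced lattice. -/
theorem IsLatticePolytope.comap_subtype (h : IsLatticePolytope L Δ) {W : Submodule ℝ V}
    (hW : Δ ⊆ W) :
    IsLatticePolytope (L.comap (W.subtype.restrictScalars ℤ)) {w : W | (w : V) ∈ Δ} := by
  classical
  obtain ⟨s, hs, rfl⟩ := h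
  have hsW : (s : Set V) ⊆ W := (subset_convexHull ℝ _).trans hW
  refine ⟨s.preimage W.subtype W.injective_subtype.injOn, ?_, ?_⟩
  · intro w hw
    exact hs (Finset.mem_preimage.1 (Finset.mem_coe.1 hw))
  · apply Set.image_injective.2 W.injective_subtype
    rw [LinearMap.image_convexHull, Finset.coe_preimage, Set.image_preimage_eq_of_subset
      (by simpa using hsW)]
    ext x
    constructor
    · rintro ⟨w, hw, rfl⟩
      exact hw
    · intro hx
      exact ⟨⟨x, hW hx⟩, hx, rfl⟩

/-- An integral form that is negative somewhere on a lattice polytope drops to `-1` on it. -/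
theorem IsLatticePolytope.exists_le_neg_one (h : IsLatticePolytope L Δ) {y : Module.Dual ℝ V}
    (hy : y ∈ dualLattice L) (hneg : ∃ x ∈ Δ, y x < 0) : ∃ x ∈ Δ, y x ≤ -1 := by
  obtain ⟨s, hs, rfl⟩ := h
  by_contra! hcon
  obtain ⟨x, hx, hxn⟩ := hneg
  have : convexHull ℝ (s : Set V) ⊆ {x | 0 ≤ y x} := by
    refine convexHull_min (fun z hz => ?_) (convex_halfSpace_ge y.isLinear 0)
    obtain ⟨n, hn⟩ := hy z (hs hz)
    have h1 := hcon z (subset_convexHull ℝ _ hz)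
    rw [hn] at h1
    have h2 : (-1 : ℤ) < n := by exact_mod_cast h1
    have h3 : (0 : ℤ) ≤ n := by lia
    rw [Set.mem_ofPred_eq, hn]
    exact_mod_cast h3
  exact absurd (this hx) (not_le.2 hxn)

end LatticePolytope

/-! ### Duality, relative interiors and reflexivity -/

section Reflexive

variable {V : Type*} [NormedAddCommGroup V] [NormedSpace ℝ V] {L : Submodule ℤ V}

theorem IsLatticePolytope.isCompact {Δ : Set V} (h : IsLatticePolytope L Δ) : IsCompact Δ := by
  obtain ⟨s, -, rfl⟩ := h
  exact s.finite_toSet.isCompact_convexHull ℝ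

/-- A point outside a closed convex set containing the origin violates an inequality of the
dual. -/
theorem mem_of_forall_dualPolytope {K : Set V} (hconv : Convex ℝ K) (hcl : IsClosed K)
    (h0 : (0 : V) ∈ K) {x : V} (hx : ∀ y ∈ dualPolytope K, -1 ≤ y x) : x ∈ K := by
  by_contra hxK
  obtain ⟨f, u, hfK, hfx⟩ := geometric_hahn_banach_closed_point hconv hcl hxK
  have hu : 0 < u := by simpa using hfK 0 h0
  -- Since `f < u` on `K` and `u > 0`, scaling by `-u⁻¹` turns the separating bound into `-1`.
  have hmem : (-u⁻¹) • (f : Module.Dual ℝ V) ∈ dualPolytope K := by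
    intro z hz
    have h1 : u⁻¹ * f z ≤ u⁻¹ * u := by gcongr; exact (hfK z hz).le
    rw [inv_mul_cancel₀ hu.ne'] at h1
    simp
    linarith
  have h1 := hx _ hmem
  have h2 : u⁻¹ * u < u⁻¹ * f x := by gcongr
  rw [inv_mul_cancel₀ hu.ne'] at h2
  simp at h1
  linarith

/-- A vector in the recession cone of a compact set described by its dual vanishes. -/
theorem eq_zero_of_forall_nonneg {K : Set V} (hK : IsCompact K) (hconv : Convex ℝ K)
    (h0 : (0 : V) ∈ K) {S : Set (Module.Dual ℝ V)} (hS : dualPolytope K = convexHull ℝ S)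
    {x : V} (hx : ∀ y ∈ S, 0 ≤ y x) : x = 0 := by
  have hD : dualPolytope K ⊆ {y | 0 ≤ y x} := by
    rw [hS]
    exact convexHull_min hx (convex_halfSpace_ge (Module.Dual.eval ℝ V x).isLinear 0)
  have hmem : ∀ t : ℝ, 0 ≤ t → t • x ∈ K := by
    intro t ht
    refine mem_of_forall_dualPolytope hconv hK.isClosed h0 fun y hy => ?_
    have := mul_nonneg ht (hD hy)
    simp only [map_smul, smul_eq_mul]
    linarith
  obtain ⟨C, hC⟩ := hK.isBounded.exists_norm_le
  by_contra hne
  have hpos : 0 < ‖x‖ := norm_pos_iff.2 hne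
  have hC0 : 0 ≤ C := by simpa using hC 0 h0
  have h1 := hC _ (hmem ((C + 1) / ‖x‖) (by positivity))
  rw [norm_smul, Real.norm_of_nonneg (by positivity), div_mul_cancel₀ _ hpos.ne'] at h1
  linarith

/-- The line through `z` and `x` stays in the affine span, where `P` is a neighbourhood of `x`. -/
theorem exists_add_smul_sub_mem_of_mem_intrinsicInterior {P : Set V} {x z : V}
    (hx : x ∈ intrinsicInterior ℝ P) (hz : z ∈ P) : ∃ ε : ℝ, 0 < ε ∧ x + ε • (x - z) ∈ P := by
  obtain ⟨a, ha, rfl⟩ := hx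
  have hline : ∀ t : ℝ, (a : V) + t • ((a : V) - z) ∈ affineSpan ℝ P := by
    intro t
    have := AffineMap.lineMap_mem (-t) a.2 (subset_affineSpan ℝ P hz)
    rw [AffineMap.lineMap_apply] at this
    convert this using 1
    simp [smul_sub]
    abel
  let g : ℝ → affineSpan ℝ P := fun t => ⟨(a : V) + t • ((a : V) - z), hline t⟩
  have hg : Continuous g := by
    refine Continuous.subtype_mk ?_ _
    fun_prop
  have hg0 : g 0 = a := by simp [g]
  have hn : g ⁻¹' ((↑) ⁻¹' P) ∈ nhds (0 : ℝ) := by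
    apply hg.continuousAt
    rw [hg0]
    exact mem_interior_iff_mem_nhds.1 ha
  obtain ⟨δ, hδ, hball⟩ := Metric.mem_nhds_iff.1 hn
  refine ⟨δ / 2, by positivity, hball (?_ : δ / 2 ∈ _)⟩
  rw [Metric.mem_ball, Real.dist_eq, sub_zero, abs_of_pos (by positivity)]
  linarith

theorem mem_intrinsicInterior_of_zero_mem_interior {P : Set V} {p : V}
    (h : (0 : vectorSpan ℝ P) ∈ interior {w : vectorSpan ℝ P | p + (w : V) ∈ P}) :
    p ∈ intrinsicInterior ℝ P := by
  have hpP : p ∈ P := by simpa using interior_subset h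
  have hpA := subset_affineSpan ℝ P hpP
  let g : affineSpan ℝ P → vectorSpan ℝ P := fun a =>
    ⟨(a : V) - p, by
      rw [← direction_affineSpan]
      exact AffineSubspace.vsub_mem_direction a.2 hpA⟩
  have hg : Continuous g := by
    refine Continuous.subtype_mk ?_ _
    fun_prop
  refine ⟨⟨p, hpA⟩, ?_, rfl⟩
  rw [mem_interior_iff_mem_nhds]
  have hg0 : g ⟨p, hpA⟩ = 0 := by simp [g]
  have := hg.continuousAt (x := ⟨p, hpA⟩) (by rw [hg0]; exact mem_interior_iff_mem_nhds.1 h)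
  filter_upwards [this] with a ha
  simpa [g] using ha

/-- A summand of a direct decomposition of a reflexive polytope is reflexive in its subspace. -/
theorem IsReflexiveAtOrigin.of_add {P Q : Set V} (hP : IsLatticePolytope L P) (hQ0 : (0 : V) ∈ Q)
    (h : IsReflexiveAtOrigin L (P + Q)) {W U : Submodule ℝ V} (hW : P ⊆ W) (hU : Q ⊆ U)
    (hWU : Disjoint W U) :
    IsReflexiveAtOrigin (L.comap (W.subtype.restrictScalars ℤ)) {w : W | (w : V) ∈ P} := by
  classical
  obtain ⟨-, h0, S, hS, hSeq⟩ := h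
  refine ⟨hP.comap_subtype hW, ?_, S.image (LinearMap.lcomp ℝ ℝ W.subtype), ?_, ?_⟩
  · rw [mem_interior_iff_mem_nhds] at h0 ⊢
    have h1 : ((↑) : W → V) ⁻¹' (P + Q) ∈ nhds (0 : W) :=
      continuous_subtype_val.continuousAt (by simpa using h0)
    filter_upwards [h1] with w hw
    obtain ⟨p, hp, q, hq, hpq⟩ := hw
    have hqW : q ∈ W := by
      have : q = w - p := by rw [← hpq]; simp
      rw [this]
      exact W.sub_mem w.2 (hW hp)
    have hq0 : q = 0 := (Submodule.disjoint_def.1 hWU) q hqW (hU hq)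
    have : (w : V) = p := by rw [← hpq, hq0]; simp
    rw [this]
    exact hp
  · intro y hy
    obtain ⟨z, hz, rfl⟩ := Finset.mem_image.1 (Finset.mem_coe.1 hy)
    intro w hw
    exact hS hz w hw
  · rw [Finset.coe_image, ← LinearMap.image_convexHull, ← hSeq]
    ext f
    constructor
    · intro hf
      -- `W` embeds in `V ⧸ U`, so `f` extends to a form vanishing on `U`; on `P + Q` it only sees
      -- the summand in `P`.
      have hinj : LinearMap.ker (U.mkQ ∘ₗ W.subtype) = ⊥ := by
        rw [LinearMap.ker_eq_bot']
        intro w hw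
        have hwU : (w : V) ∈ U := by simpa using hw
        exact Subtype.ext (Submodule.disjoint_def.1 hWU w w.2 hwU)
      obtain ⟨g, hg⟩ := LinearMap.exists_leftInverse_of_injective _ hinj
      refine ⟨f ∘ₗ g ∘ₗ U.mkQ, ?_, ?_⟩
      · rintro _ ⟨p, hp, q, hq, rfl⟩
        have h1 : g (U.mkQ p) = ⟨p, hW hp⟩ := LinearMap.congr_fun hg ⟨p, hW hp⟩
        have h2 : U.mkQ q = 0 := by simpa using hU hq
        simp only [LinearMap.comp_apply, map_add, h1, h2, map_zero, add_zero]
        exact hf ⟨p, hW hp⟩ hp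
      · ext w
        have h1 : g (U.mkQ w) = w := LinearMap.congr_fun hg w
        simp only [LinearMap.lcomp_apply, LinearMap.comp_apply, Submodule.subtype_apply, h1]
    · rintro ⟨y, hy, rfl⟩ w hw
      exact hy w ⟨w, hw, 0, hQ0, by simp⟩

/-- The origin splits between the summands of a reflexive polytope: if it lies in the relative
interior of `P`, then it lies in `Q` and the spans of `P` and `Q` meet only in the origin. -/
theorem IsReflexiveAtOrigin.zero_mem_and_disjoint_span {P Q : Set V}
    (hP : IsLatticePolytope L P) (hQ : Convex ℝ Q)
    (h : IsReflexiveAtOrigin L (P + Q)) (hrel : ∀ x ∈ P, ∃ ε : ℝ, 0 < ε ∧ -(ε • x) ∈ P) :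
    (0 : V) ∈ Q ∧ Disjoint (Submodule.span ℝ P) (Submodule.span ℝ Q) := by
  obtain ⟨hK, h0, S, hS, hSeq⟩ := h
  have h0K := interior_subset h0
  have hzero : ∀ x : V, (∀ y ∈ (S : Set (Module.Dual ℝ V)), 0 ≤ y x) → x = 0 := fun x =>
    eq_zero_of_forall_nonneg hK.isCompact hK.convex h0K hSeq
  have hdual : ∀ y ∈ S, ∀ x ∈ P + Q, -1 ≤ y x := fun y hy =>
    (hSeq ▸ subset_convexHull ℝ _ hy : y ∈ dualPolytope (P + Q))
  have hdich : ∀ y ∈ S, Submodule.span ℝ P ≤ LinearMap.ker y ∨ ∀ q ∈ Q, 0 ≤ y q := by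
    intro y hy
    by_cases hneg : ∃ x ∈ P, y x < 0
    · right
      intro q hq
      obtain ⟨x, hx, hxy⟩ := hP.exists_le_neg_one (hS hy) hneg
      have := hdual y hy _ (Set.add_mem_add hx hq)
      rw [map_add] at this
      linarith
    · left
      push Not at hneg
      refine Submodule.span_le.2 fun x hx => ?_
      obtain ⟨ε, hε, hεx⟩ := hrel x hx
      have h1 := hneg _ hεx
      have h2 := hneg _ hx
      rw [map_neg, map_smul, smul_eq_mul] at h1
      have h3 : y x ≤ 0 := by
        by_contra! h4
        have := mul_pos hε h4
        linarith
      exact le_antisymm h3 h2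
  have hcap : ∀ q ∈ Q, q ∈ Submodule.span ℝ P → q = 0 := fun q hq hqW =>
    hzero q fun y hy => (hdich y hy).elim (fun hk => (hk hqW).ge) (fun hn => hn q hq)
  have h0Q : (0 : V) ∈ Q := by
    obtain ⟨p, hp, q, hq, hpq⟩ := h0K
    have hqp : q = -p := (neg_eq_of_add_eq_zero_right hpq).symm
    have := hcap q hq (hqp ▸ Submodule.neg_mem _ (Submodule.subset_span hp))
    exact this ▸ hq
  refine ⟨h0Q, Submodule.disjoint_def.2 fun x hxW hxU => hzero x fun y hy => ?_⟩
  rcases hdich y hy with hk | hn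
  · exact (hk hxW).ge
  -- For `q ∈ Q`, write `-(ε • q) = p + r`. Then `r + ε • q = -p` lies in the span of `P` and, after
  -- rescaling, in `Q`, so it is `0`. As `y ≥ 0` at both `r` and `q`, it vanishes at `q`.
  suffices hU : Submodule.span ℝ Q ≤ LinearMap.ker y from (hU hxU).ge
  refine Submodule.span_le.2 fun q hq => le_antisymm ?_ (hn q hq)
  have hnhds : (fun t : ℝ => -(t • q)) ⁻¹' (P + Q) ∈ nhds (0 : ℝ) := by
    have hc : Continuous fun t : ℝ => -(t • q) := by fun_prop
    exact hc.continuousAt (by simpa using mem_interior_iff_mem_nhds.1 h0)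
  obtain ⟨δ, hδ, hball⟩ := Metric.mem_nhds_iff.1 hnhds
  obtain ⟨ε, hε, hεm⟩ : ∃ ε : ℝ, 0 < ε ∧ -(ε • q) ∈ P + Q := by
    refine ⟨δ / 2, by positivity, hball (?_ : δ / 2 ∈ _)⟩
    rw [Metric.mem_ball, Real.dist_eq, sub_zero, abs_of_pos (by positivity)]
    linarith
  obtain ⟨p, hp, r, hr, hpr⟩ := hεm
  have hsum : r + ε • q = -p := by
    have : r = -(ε • q) - p := by rw [← hpr]; simp
    rw [this]; abel
  have hcomb : (1 + ε)⁻¹ • (r + ε • q) ∈ Q := by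
    have := hQ hr hq (a := (1 + ε)⁻¹) (b := (1 + ε)⁻¹ * ε) (by positivity) (by positivity)
      (by field_simp)
    rwa [smul_add, smul_smul]
  have hz := hcap _ hcomb (by
    rw [hsum]
    exact Submodule.smul_mem _ _ (Submodule.neg_mem _ (Submodule.subset_span hp)))
  have hz' : r + ε • q = 0 := (smul_eq_zero.1 hz).resolve_left (by positivity)
  have h1 : y r + ε * y q = 0 := by simpa using congrArg y hz'
  have h2 := hn r hr
  by_contra! h3
  have := mul_pos hε h3
  linarith

/-- A reflexive polytope has no nonzero lattice point `x` with `(1 + ε) x` in it. -/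
theorem IsReflexiveAtOrigin.eq_zero_of_smul_mem {K : Set V} (h : IsReflexiveAtOrigin L K)
    {x : V} (hxL : x ∈ L) {ε : ℝ} (hε : 0 < ε) (hx : x + ε • x ∈ K) : x = 0 := by
  obtain ⟨hK, h0, S, hS, hSeq⟩ := h
  refine eq_zero_of_forall_nonneg hK.isCompact hK.convex (interior_subset h0) hSeq fun y hy => ?_
  have h1 := (hSeq ▸ subset_convexHull ℝ _ hy : y ∈ dualPolytope K) _ hx
  obtain ⟨n, hn⟩ := hS hy x hxL
  rw [map_add, map_smul, smul_eq_mul, hn] at h1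
  rw [hn]
  -- A negative integer value is at most `-1`, and the factor `1 + ε` pushes it strictly below `-1`.
  by_contra! hneg
  have h2 : n ≤ -1 := by
    have : n < 0 := by exact_mod_cast hneg
    lia
  have h3 : (n : ℝ) ≤ -1 := by exact_mod_cast h2
  nlinarith

theorem setOf_add_mem_subset_vectorSpan {P : Set V} {p : V} (hp : p ∈ P) :
    {x | p + x ∈ P} ⊆ (vectorSpan ℝ P : Set V) := fun x hx => by
  have hx' : p + x ∈ P := hx
  simpa using vsub_mem_vectorSpan ℝ hx' hp

theorem vectorSpan_eq_span_setOf_add_mem {P : Set V} {p : V} (hp : p ∈ P) :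
    vectorSpan ℝ P = Submodule.span ℝ {x | p + x ∈ P} := by
  refine le_antisymm ?_ (Submodule.span_le.2 (setOf_add_mem_subset_vectorSpan hp))
  rw [vectorSpan_eq_span_vsub_set_right ℝ hp]
  refine Submodule.span_mono ?_
  rintro _ ⟨x, hx, rfl⟩
  simpa using hx

theorem IsReflexiveInSpan.of_add {P Q : Set V} {p q : V} (hP : IsLatticePolytope L P)
    (hp : p ∈ P) (hpL : p ∈ L) (hq : q ∈ Q)
    (h : IsReflexiveAtOrigin L {x | p + q + x ∈ P + Q})
    (hdisj : Disjoint (vectorSpan ℝ P) (vectorSpan ℝ Q)) : IsReflexiveInSpan L P := by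
  have hO : IsReflexiveAtOrigin (L.comap ((vectorSpan ℝ P).subtype.restrictScalars ℤ))
      {w : vectorSpan ℝ P | p + (w : V) ∈ P} :=
    IsReflexiveAtOrigin.of_add (hP.translate hpL) (by simpa using hq)
      (setOf_add_mem_add P Q p q ▸ h) (setOf_add_mem_subset_vectorSpan hp)
      (setOf_add_mem_subset_vectorSpan hq) hdisj
  refine ⟨p, ?_, hO⟩
  refine Set.eq_singleton_iff_unique_mem.2
    ⟨⟨mem_intrinsicInterior_of_zero_mem_interior hO.2.1, hpL⟩, ?_⟩
  rintro x ⟨hx, hxL⟩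
  -- Extending the segment from `p` past a second relatively interior lattice point `x`, then adding
  -- `q`, stays in `P + Q`.
  obtain ⟨ε, hε, hmem⟩ := exists_add_smul_sub_mem_of_mem_intrinsicInterior hx hp
  refine sub_eq_zero.1 (h.eq_zero_of_smul_mem (L.sub_mem hxL hpL) hε ?_)
  refine ⟨_, hmem, q, hq, ?_⟩
  change x + ε • (x - p) + q = p + q + (x - p + ε • (x - p))
  abel

end Reflexive

theorem mainTheorem7 {V : Type*} [NormedAddCommGroup V] [NormedSpace ℝ V]
    [FiniteDimensional ℝ V] (L : Submodule ℤ V) [DiscreteTopology L] [IsZLattice ℝ L]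
    (P Q : Set V) (hP : IsLatticePolytope L P) (hQ : IsLatticePolytope L Q)
    (hPQ : IsReflexive L (P + Q))
    (hint : ∃ p ∈ L, p ∈ intrinsicInterior ℝ P) :
    IsReflexiveInSpan L P ∧ IsReflexiveInSpan L Q ∧ IsNefPartition L ![P, Q] := by
  obtain ⟨m, hm⟩ := hPQ
  obtain ⟨p, hpL, hpi⟩ := hint
  have hp : p ∈ P := intrinsicInterior_subset hpi
  have hmL : m ∈ L := (hm.1.ge rfl : m ∈ interior (P + Q) ∩ L).2
  -- `q` is a lattice point by construction; that it lies in `Q` is the real content.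
  obtain ⟨q, rfl⟩ : ∃ q, m = p + q := ⟨m - p, by simp⟩
  have hqL : q ∈ L := by simpa using L.sub_mem hmL hpL
  obtain ⟨hq, hdisj⟩ := IsReflexiveAtOrigin.zero_mem_and_disjoint_span (hP.translate hpL)
    (hQ.translate hqL).convex (setOf_add_mem_add P Q p q ▸ hm.2) fun x hx => by
      obtain ⟨ε, hε, h⟩ := exists_add_smul_sub_mem_of_mem_intrinsicInterior hpi hx
      exact ⟨ε, hε, by simpa using h⟩
  replace hq : q ∈ Q := by simpa using hq
  rw [← vectorSpan_eq_span_setOf_add_mem hp, ← vectorSpan_eq_span_setOf_add_mem hq] at hdisj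
  refine ⟨.of_add hP hp hpL hq hm.2 hdisj,
    .of_add hQ hq hqL hp (by simpa only [add_comm q p, add_comm Q P] using hm.2) hdisj.symm,
    Fin.forall_fin_two.2 ⟨hP, hQ⟩, p + q, by simpa [Fin.sum_univ_two] using hm, ![p, q],
    Fin.forall_fin_two.2 ⟨⟨hp, hpL⟩, ⟨hq, hqL⟩⟩, by simp [Fin.sum_univ_two]⟩
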